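/- Let $K$ be an algebraically closed field, let $I\subset K[t_0,\dots,t_m]$ be a homogeneous ideal such that $X=V(I)\subset\mathbb P^m_K$ is irreducible (in particular nonempty), let $I(X)$ be the ideal of all polynomials vanishing on $X$, and let $R=K[t_0,\dots,t_m]/I(X)$. Let $f_0,\dots,f_n\in K[t_0,\dots,t_m]$ be homogeneous of the same degree, not all in $I(X)$, and let $\Phi:X\dashrightarrow\mathbb P^n_K$, $t\mapsto(f_0(t):\dots:f_n(t))$, be the rational map they define, i.e. the class of all morphisms $U\to\mathbb P^n_K$ with $\emptyset\ne U\subset X$ open that agree with $(f_0:\dots:f_n)$ wherever both are defined. Put $$J=\langle x_if_j-x_jf_i \mid 0\le i,j\le n\rangle,\qquad G=(I+J):\langle f_0,\dots,f_n\rangle^\infty\subset K[t_0,\dots,t_m,x_0,\dots,x_n].$$ Let $\mathcal B$ be a finite Gröbner basis of $G$, with respect to any monomial order (for instance an elimination order for $t_0,\dots,t_m$), consisting of polynomials that are bihomogeneous in $(t,x)$. Let $\alpha$ be the matrix over $R$ with $n+1$ columns such that the entries of $\alpha\cdot(x_0,\dots,x_n)^t$ are the images in $R[x_0,\dots,x_n]$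 of the elements of $\mathcal B$ of bidegree $(r,1)$, $r\ge 0$. Call $g\in R^{n+1}$ a representative of $\Phi$ if its entries are the classes of homogeneous polynomials of one common degree and $t\mapsto(g_0(t):\dots:g_n(t))$ is a morphism on the nonempty open set $X\setminus V(g_0,\dots,g_n)$ belonging to the class $\Phi$. Then: 1. a tuple $g\in R^{n+1}$ is a representative of $\Phi$ if and only if it is nonzero, lies in $\ker(\alpha)$, and its entries are the classes of homogeneous polynomials of one common degree; 2. $\ker(\alpha)\subset R^{n+1}$ is the $R$-module generated by the representatives of $\Phi$, and $$\ker(\alpha)=\{g\in R^{n+1} \mid g_i\overline{f_j}=g_j\overline{f_i}\ \text{ for all } 0\le i,j\le n\};$$ 3. if $\beta=[\beta_1\ \cdots\ \beta_k]$ is any matrix over $R$ with $\operatorname{im}(\beta)=\ker(\alpha)$, then the domain of definition of $\Phi$, i.e. the largest open subset of $X$ on which a morphism of the class $\Phi$ is defined, is $$D(\Phi)=X\setminus\bigcap_{l=1}^{k}V(\langle\beta_l\rangle),$$ where $\langle\beta_l\rangle\subset R$ is the ideal generated by the entries of the column $\beta_l$, and $V(\langle\beta_l\rangle)$ is the set of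 points at which all polynomials with class in $\langle\beta_l\rangle$ vanish (at all vectors of homogeneous coordinates). -/

import Mathlib

open scoped LinearAlgebra.Projectivization

noncomputable section

namespace RationalMapDomain

/-! ### Projective space with its Zariski topology -/

/-- The set of `K`-points of the projective space of dimension `n`. -/
abbrev ProjSpace (K : Type*) [Field K] (n : ℕ) : Type _ := ℙ K (Fin (n + 1) → K)

/-- `F` vanishes at the point `p`: it is zero at all vectors of homogeneous coordinates of `p`.
For homogeneous `F` one vector of coordinates is enough. -/
def VanishesAt {K : Type*} [Field K] {n : ℕ} (F : MvPolynomial (Fin (n + 1)) K)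
    (p : ProjSpace K n) : Prop :=
  ∀ (v : Fin (n + 1) → K) (hv : v ≠ 0), Projectivization.mk K v hv = p → MvPolynomial.eval v F = 0

/-- The projective vanishing locus of a set of polynomials. -/
def zeroLocus {K : Type*} [Field K] {n : ℕ} (S : Set (MvPolynomial (Fin (n + 1)) K)) :
    Set (ProjSpace K n) :=
  {p | ∀ F ∈ S, VanishesAt F p}

/-- The Zariski topology on projective space: the non-vanishing loci of homogeneous polynomials
are a basis of it. -/
instance zariskiTopology (K : Type*) [Field K] (n : ℕ) : TopologicalSpace (ProjSpace K n) :=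
  TopologicalSpace.generateFrom
    {U | ∃ (d : ℕ) (F : MvPolynomial (Fin (n + 1)) K), F.IsHomogeneous d ∧ U = (zeroLocus {F})ᶜ}

/-- The ideal `I(X)` of all polynomials that vanish on `X`. -/
def vanishingIdeal {K : Type*} [Field K] {n : ℕ} (X : Set (ProjSpace K n)) :
    Ideal (MvPolynomial (Fin (n + 1)) K) where
  carrier := {F | ∀ p ∈ X, VanishesAt F p}
  add_mem' := by
    intro a b ha hb p hp v hv h
    rw [map_add, ha p hp v hv h, hb p hp v hv h, add_zero]
  zero_mem' := by
    intro p _ v _ _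
    exact map_zero _
  smul_mem' := by
    intro c a ha p hp v hv h
    rw [smul_eq_mul, map_mul, ha p hp v hv h, mul_zero]

/-- The homogeneous coordinate ring `R = K[t₀, …, tₘ] / I(X)`. -/
abbrev CoordRing {K : Type*} [Field K] {m : ℕ} (X : Set (ProjSpace K m)) : Type _ :=
  MvPolynomial (Fin (m + 1)) K ⧸ vanishingIdeal X

/-! ### Regular functions, morphisms and rational maps -/

/-- The function `h` is regular on the subset `U` of projective space (only its values on `U`
matter): locally on `U` it is a quotient of homogeneous polynomials of the same degree. -/
def IsRegularOn {K : Type*} [Field K] {n : ℕ} (U : Set (ProjSpace K n)) (h : ProjSpace K n → K) :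
    Prop :=
  ∀ p ∈ U, ∃ W : Set (ProjSpace K n), IsOpen W ∧ p ∈ W ∧
    ∃ (d : ℕ) (A B : MvPolynomial (Fin (n + 1)) K), A.IsHomogeneous d ∧ B.IsHomogeneous d ∧
      ∀ q ∈ U ∩ W, MvPolynomial.eval q.rep B ≠ 0 ∧
        h q = MvPolynomial.eval q.rep A / MvPolynomial.eval q.rep B

/-- The restriction of `φ` to `U` is a morphism from `U` to projective space: it is continuous and
pulls regular functions on open sets back to regular functions. -/
def IsMorphismOn {K : Type*} [Field K] {m n : ℕ} (U : Set (ProjSpace K m))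
    (φ : ProjSpace K m → ProjSpace K n) : Prop :=
  ContinuousOn φ U ∧ ∀ (V : Set (ProjSpace K n)) (h : ProjSpace K n → K), IsOpen V →
    IsRegularOn V h → IsRegularOn (U ∩ φ ⁻¹' V) (h ∘ φ)

/-- The polynomials `g₀, …, gₙ` do not all vanish at `p`, and `(g₀(p) : … : gₙ(p)) = q`. -/
def IsValueAt {K : Type*} [Field K] {m n : ℕ} (g : Fin (n + 1) → MvPolynomial (Fin (m + 1)) K)
    (p : ProjSpace K m) (q : ProjSpace K n) : Prop :=
  ∃ h : (fun i => MvPolynomial.eval p.rep (g i)) ≠ 0, Projectivization.mk K _ h = q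

/-- The morphism `φ : U → ℙⁿ` belongs to the rational map `Φ = (f₀ : … : fₙ)` on `X` (an equivalence
class of morphisms): `U` is a nonempty open subset of `X`, `φ` is a morphism on `U`, and `φ` agrees
with `t ↦ (f₀(t) : … : fₙ(t))` wherever both are defined. -/
def InClass {K : Type*} [Field K] {m n : ℕ} (X : Set (ProjSpace K m))
    (f : Fin (n + 1) → MvPolynomial (Fin (m + 1)) K) (U : Set (ProjSpace K m))
    (φ : ProjSpace K m → ProjSpace K n) : Prop :=
  U.Nonempty ∧ (∃ O : Set (ProjSpace K m), IsOpen O ∧ U = X ∩ O) ∧ IsMorphismOn U φ ∧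
    ∀ p ∈ U \ zeroLocus (Set.range f), IsValueAt f p (φ p)

/-- `D` is the domain of definition of the rational map `(f₀ : … : fₙ)` on `X`: the largest open
subset of `X` on which a morphism of the class is defined. -/
def IsDomainOfDefinition {K : Type*} [Field K] {m n : ℕ} (X : Set (ProjSpace K m))
    (f : Fin (n + 1) → MvPolynomial (Fin (m + 1)) K) (D : Set (ProjSpace K m)) : Prop :=
  IsGreatest {U | ∃ φ : ProjSpace K m → ProjSpace K n, InClass X f U φ} D

/-- `G` consists of homogeneous polynomials of one common degree which represent the classes `g`. -/
def IsHomogeneousLift {K : Type*} [Field K] {m n : ℕ} (X : Set (ProjSpace K m))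
    (g : Fin (n + 1) → CoordRing X) (G : Fin (n + 1) → MvPolynomial (Fin (m + 1)) K) : Prop :=
  (∃ e : ℕ, ∀ i, (G i).IsHomogeneous e) ∧ ∀ i, Ideal.Quotient.mk (vanishingIdeal X) (G i) = g i

/-- The tuple `g ∈ Rⁿ⁺¹` is a representative of the rational map `(f₀ : … : fₙ)` on `X`: its entries
are homogeneous of the same degree, and `t ↦ (g₀(t) : … : gₙ(t))` on `X \ V(g₀, …, gₙ)` is a
morphism in the class. -/
def IsRepresentative {K : Type*} [Field K] {m n : ℕ} (X : Set (ProjSpace K m))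
    (f : Fin (n + 1) → MvPolynomial (Fin (m + 1)) K) (g : Fin (n + 1) → CoordRing X) : Prop :=
  ∃ G : Fin (n + 1) → MvPolynomial (Fin (m + 1)) K, IsHomogeneousLift X g G ∧
    ∃ φ : ProjSpace K m → ProjSpace K n, InClass X f (X \ zeroLocus (Set.range G)) φ ∧
      ∀ p ∈ X \ zeroLocus (Set.range G), IsValueAt G p (φ p)

/-! ### The ideal of the graph -/

/-- The saturation `I : J^∞`. -/
def saturation {A : Type*} [CommRing A] (I J : Ideal A) : Ideal A where
  carrier := {a | ∃ N : ℕ, ∀ g ∈ J, a * g ^ N ∈ I}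
  add_mem' := by
    rintro a b ⟨N, hN⟩ ⟨M, hM⟩
    refine ⟨N + M, fun g hg => ?_⟩
    have e : (a + b) * g ^ (N + M) = a * g ^ N * g ^ M + b * g ^ M * g ^ N := by ring
    rw [e]
    exact I.add_mem (I.mul_mem_right _ (hN g hg)) (I.mul_mem_right _ (hM g hg))
  zero_mem' := ⟨0, fun g _ => by rw [zero_mul]; exact I.zero_mem⟩
  smul_mem' := by
    rintro c a ⟨N, hN⟩
    refine ⟨N, fun g hg => ?_⟩
    rw [smul_eq_mul, mul_assoc]
    exact I.mul_mem_left _ (hN g hg)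

/-- The polynomial ring `K[t₀, …, tₘ, x₀, …, xₙ]`; `Sum.inl` is for the `t`, `Sum.inr` for the `x`. -/
abbrev BiPoly (K : Type*) [Field K] (m n : ℕ) : Type _ :=
  MvPolynomial (Fin (m + 1) ⊕ Fin (n + 1)) K

/-- The inclusion of `K[t₀, …, tₘ]` into `K[t₀, …, tₘ, x₀, …, xₙ]`. -/
def inclT (K : Type*) [Field K] (m n : ℕ) : MvPolynomial (Fin (m + 1)) K →ₐ[K] BiPoly K m n :=
  MvPolynomial.rename Sum.inl

/-- The ideal of the `2 × 2` minors of the matrix with rows `x₀, …, xₙ` and `f₀, …, fₙ`. -/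
def minorsIdeal {K : Type*} [Field K] {m n : ℕ}
    (f : Fin (n + 1) → MvPolynomial (Fin (m + 1)) K) : Ideal (BiPoly K m n) :=
  Ideal.span {F | ∃ i j : Fin (n + 1),
    F = MvPolynomial.X (Sum.inr i) * inclT K m n (f j)
      - MvPolynomial.X (Sum.inr j) * inclT K m n (f i)}

/-- The graph ideal `G = (I + J) : ⟨f₀, …, fₙ⟩^∞`. -/
def graphIdeal {K : Type*} [Field K] {m n : ℕ} (I : Ideal (MvPolynomial (Fin (m + 1)) K))
    (f : Fin (n + 1) → MvPolynomial (Fin (m + 1)) K) : Ideal (BiPoly K m n) :=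
  saturation (I.map (inclT K m n) ⊔ minorsIdeal f)
    (Ideal.span (Set.range fun i => inclT K m n (f i)))

/-! ### Gröbner bases and the matrix of the elements that are linear in `x` -/

/-- `F` is bihomogeneous of bidegree `(r, s)`: degree `r` in the `t` and degree `s` in the `x`. -/
def IsBihomogeneous {K : Type*} [Field K] {m n : ℕ} (r s : ℕ) (F : BiPoly K m n) : Prop :=
  ∀ d ∈ F.support, ∑ i, d (Sum.inl i) = r ∧ ∑ j, d (Sum.inr j) = s

/-- `B` is a Gröbner basis of `G` for the monomial order `ord`: it lies in `G`, and the leading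
monomial of every nonzero element of `G` is divisible by that of a nonzero element of `B`. -/
def IsGroebnerBasis {σ K : Type*} [Field K] (ord : MonomialOrder σ)
    (B : Finset (MvPolynomial σ K)) (G : Ideal (MvPolynomial σ K)) : Prop :=
  (∀ b ∈ B, b ∈ G) ∧ ∀ F ∈ G, F ≠ 0 → ∃ b ∈ B, b ≠ 0 ∧ ord.degree b ≤ ord.degree F

/-- The elements of `B` that are of bidegree `(r, 1)` for some `r`. -/
abbrev LinearElements {K : Type*} [Field K] {m n : ℕ} (B : Finset (BiPoly K m n)) : Type _ :=
  {b : BiPoly K m n // b ∈ B ∧ ∃ r : ℕ, IsBihomogeneous r 1 b}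

/-- The canonical map `K[t₀, …, tₘ, x₀, …, xₙ] → R[x₀, …, xₙ]`. -/
def toCoordRingX {K : Type*} [Field K] {m : ℕ} (X : Set (ProjSpace K m)) (n : ℕ) :
    BiPoly K m n →ₐ[K] MvPolynomial (Fin (n + 1)) (CoordRing X) :=
  MvPolynomial.aeval (Sum.elim
    (fun i => MvPolynomial.C (Ideal.Quotient.mk (vanishingIdeal X) (MvPolynomial.X i)))
    MvPolynomial.X)

/-- The entries of `α · (x₀, …, xₙ)ᵗ` are the bidegree `(r, 1)` elements of `B`, read in
`R[x₀, …, xₙ]`. -/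
def IsLinearMatrix {K : Type*} [Field K] {m n : ℕ} (X : Set (ProjSpace K m))
    (B : Finset (BiPoly K m n)) (α : Matrix (LinearElements B) (Fin (n + 1)) (CoordRing X)) : Prop :=
  ∀ b : LinearElements B, (α.map MvPolynomial.C).mulVec MvPolynomial.X b = toCoordRingX X n b.1

end RationalMapDomain

end

noncomputable section

namespace RationalMapDomain

section Points

/-! ### Vanishing of polynomials at points of projective space -/

/-! Everything passes through the module `proportionalTuples X f` of tuples over `R` proportional to
`f`. Since `X` is irreducible, `R` is a domain.

The kernel of `α` is this module (`ker_eq_proportionalTuples`). Substituting `x = f` kills `G`, so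
the linear elements of `B` vanish at `f`, hence, after cancelling some nonzero `f_k`, at every tuple
proportional to `f`. Conversely, for `g` in the kernel, substitute `x = ε g` over the dual numbers:
elements of `B` of `x`-degree 0 vanish because they vanish at `x = f`, those of degree 1 because `α
g = 0`, those of higher degree because `ε² = 0`. A Gröbner basis generates `G`, so the minors `x_i
f_j - x_j f_i` vanish too, and their `ε`-coefficients say that `g` is proportional to `f`.

Geometrically, a morphism of the class is locally given by homogeneous tuples
(`IsMorphismOn.exists_isValueAt`). Such a tuple is proportional to `f` on a nonempty open subset of
`X`, hence on all of `X` by irreducibility. Conversely, homogeneous proportional tuples agree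
wherever they are nonzero and glue to a morphism (`exists_inClass`). So the representatives are the
nonzero homogeneous elements of the module, which generate it because it is graded, and the domain
of definition is the set of points where some element of the module does not vanish. -/

theorem aeval_mul_of_isHomogeneous {S A σ : Type*} [CommSemiring S] [CommSemiring A] [Algebra S A]
    {F : MvPolynomial σ S} {e : ℕ} (hF : F.IsHomogeneous e) (c : A) (v : σ → A) :
    MvPolynomial.aeval (fun i => c * v i) F = c ^ e * MvPolynomial.aeval v F := by
  rw [MvPolynomial.aeval_def, MvPolynomial.aeval_def, MvPolynomial.eval₂_eq,
    MvPolynomial.eval₂_eq, Finset.mul_sum]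
  refine Finset.sum_congr rfl fun d hd => ?_
  have h : ∑ i ∈ d.support, d i = e := by
    rw [← hF.degree_eq_sum_deg_support hd]
  simp only [mul_pow, Finset.prod_mul_distrib, Finset.prod_pow_eq_pow_sum, h]
  ring

theorem eval_smul_of_isHomogeneous {K σ : Type*} [CommSemiring K]
    {F : MvPolynomial σ K} {e : ℕ} (hF : F.IsHomogeneous e) (c : K) (v : σ → K) :
    MvPolynomial.eval (c • v) F = c ^ e * MvPolynomial.eval v F := by
  have h := aeval_mul_of_isHomogeneous hF c v
  simp only [MvPolynomial.aeval_eq_eval] at h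
  exact h

variable {K : Type*} [Field K] {n : ℕ}

/-- Restriction of polynomials to the line through `v`, parametrized by `c ↦ c • v`. -/
def lineHom {σ : Type*} (v : σ → K) : MvPolynomial σ K →ₐ[K] Polynomial K :=
  MvPolynomial.aeval fun i => Polynomial.X * Polynomial.C (v i)

theorem eval_lineHom {σ : Type*} (v : σ → K) (c : K) (F : MvPolynomial σ K) :
    (lineHom v F).eval c = MvPolynomial.eval (c • v) F := by
  have h : (Polynomial.evalRingHom c).comp (lineHom v : MvPolynomial σ K →+* Polynomial K) =
      MvPolynomial.eval (c • v) := by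
    ext i <;> simp [lineHom, mul_comm c]
  exact DFunLike.congr_fun h F

theorem lineHom_of_isHomogeneous {σ : Type*} (v : σ → K) {F : MvPolynomial σ K} {e : ℕ}
    (hF : F.IsHomogeneous e) :
    lineHom v F = Polynomial.C (MvPolynomial.eval v F) * Polynomial.X ^ e := by
  have h : MvPolynomial.aeval (fun i => Polynomial.C (v i)) F =
      Polynomial.C (MvPolynomial.eval v F) := by
    have h' : (MvPolynomial.aeval (R := K) (fun i => Polynomial.C (v i)) :
        MvPolynomial σ K →+* Polynomial K) = Polynomial.C.comp (MvPolynomial.eval v) := by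
      ext i <;> simp
    exact DFunLike.congr_fun h' F
  rw [lineHom, aeval_mul_of_isHomogeneous hF, h, mul_comm]

/-- On the line through `v` the component of degree `e` becomes a multiple of `X ^ e`, so different
components cannot cancel. -/
theorem coeff_lineHom {σ : Type*} (v : σ → K) (F : MvPolynomial σ K) (e : ℕ) :
    (lineHom v F).coeff e = MvPolynomial.eval v (MvPolynomial.homogeneousComponent e F) := by
  conv_lhs => rw [← MvPolynomial.sum_homogeneousComponent F]
  rw [map_sum, Polynomial.finsetSum_coeff]
  simp only [lineHom_of_isHomogeneous v (MvPolynomial.homogeneousComponent_isHomogeneous _ F),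
    Polynomial.coeff_C_mul_X_pow]
  rw [Finset.sum_ite_eq]
  split_ifs with h
  · rfl
  · rw [MvPolynomial.homogeneousComponent_eq_zero _ _ (by simpa using h), map_zero]

/-- The coordinate vectors of the point are the nonzero multiples of `v`, and over an infinite field
a univariate polynomial zero at all nonzero scalars is zero. Vanishing at a point is thus membership
in the kernel of a ring map to the domain `K[X]`, also for inhomogeneous `F`. -/
theorem vanishesAt_mk_iff [Infinite K] (F : MvPolynomial (Fin (n + 1)) K) (v : Fin (n + 1) → K)
    (hv : v ≠ 0) : VanishesAt F (Projectivization.mk K v hv) ↔ lineHom v F = 0 := by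
  constructor
  · intro h
    refine Polynomial.eq_zero_of_infinite_isRoot _ ?_
    refine Set.Infinite.mono (s := {0}ᶜ) (fun c hc => ?_) (Set.finite_singleton 0).infinite_compl
    rw [Set.mem_ofPred_eq, Polynomial.IsRoot.def, eval_lineHom]
    refine h _ (smul_ne_zero hc hv) ?_
    rw [Projectivization.mk_eq_mk_iff']
    exact ⟨c, rfl⟩
  · intro h w hw hvw
    rw [Projectivization.mk_eq_mk_iff'] at hvw
    obtain ⟨a, rfl⟩ := hvw
    rw [← eval_lineHom, h, Polynomial.eval_zero]

theorem vanishesAt_iff [Infinite K] (F : MvPolynomial (Fin (n + 1)) K) (p : ProjSpace K n) :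
    VanishesAt F p ↔ lineHom p.rep F = 0 := by
  rw [← vanishesAt_mk_iff F p.rep p.rep_nonzero, p.mk_rep]

theorem vanishesAt_iff_homogeneousComponent [Infinite K] (F : MvPolynomial (Fin (n + 1)) K)
    (p : ProjSpace K n) :
    VanishesAt F p ↔ ∀ e, MvPolynomial.eval p.rep (MvPolynomial.homogeneousComponent e F) = 0 := by
  rw [vanishesAt_iff, Polynomial.ext_iff]
  simp only [coeff_lineHom, Polynomial.coeff_zero]

theorem vanishesAt_iff_of_isHomogeneous {F : MvPolynomial (Fin (n + 1)) K} {e : ℕ}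
    (hF : F.IsHomogeneous e) (p : ProjSpace K n) :
    VanishesAt F p ↔ MvPolynomial.eval p.rep F = 0 := by
  constructor
  · intro h
    exact h _ p.rep_nonzero p.mk_rep
  · intro h v hv hvp
    obtain ⟨a, ha⟩ := (Projectivization.mk_eq_mk_iff' K v p.rep hv p.rep_nonzero).1
      (hvp.trans p.mk_rep.symm)
    rw [← ha, eval_smul_of_isHomogeneous hF, h, mul_zero]

theorem VanishesAt.mul_iff [Infinite K] {F G : MvPolynomial (Fin (n + 1)) K} {p : ProjSpace K n} :
    VanishesAt (F * G) p ↔ VanishesAt F p ∨ VanishesAt G p := by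
  simp only [vanishesAt_iff, map_mul, mul_eq_zero]

theorem isOpen_compl_zeroLocus_singleton {F : MvPolynomial (Fin (n + 1)) K} {e : ℕ}
    (hF : F.IsHomogeneous e) : IsOpen (zeroLocus {F})ᶜ :=
  TopologicalSpace.isOpen_generateFrom_of_mem ⟨e, F, hF, rfl⟩

theorem isClosed_zeroLocus [Infinite K] (S : Set (MvPolynomial (Fin (n + 1)) K)) :
    IsClosed (zeroLocus S) := by
  have h : zeroLocus S =
      ⋂ F ∈ S, ⋂ e : ℕ, zeroLocus {MvPolynomial.homogeneousComponent e F} := by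
    ext p
    simp only [zeroLocus, Set.mem_ofPred_eq, Set.mem_iInter, Set.mem_singleton_iff, forall_eq]
    refine forall₂_congr fun F _ => ?_
    rw [vanishesAt_iff_homogeneousComponent]
    exact forall_congr' fun e => (vanishesAt_iff_of_isHomogeneous
      (MvPolynomial.homogeneousComponent_isHomogeneous e F) p).symm
  rw [h]
  exact isClosed_biInter fun F _ => isClosed_iInter fun e => isOpen_compl_iff.1
    (isOpen_compl_zeroLocus_singleton (MvPolynomial.homogeneousComponent_isHomogeneous e F))

theorem mem_zeroLocus_range_iff {m : ℕ} {G : Fin (n + 1) → MvPolynomial (Fin (m + 1)) K} {e : ℕ}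
    (hG : ∀ i, (G i).IsHomogeneous e) (p : ProjSpace K m) :
    p ∈ zeroLocus (Set.range G) ↔ (fun i => MvPolynomial.eval p.rep (G i)) = 0 := by
  simp only [zeroLocus, Set.mem_ofPred_eq, Set.forall_mem_range, funext_iff, Pi.zero_apply]
  exact forall_congr' fun i => vanishesAt_iff_of_isHomogeneous (hG i) p

theorem mem_vanishingIdeal {X : Set (ProjSpace K n)} {F : MvPolynomial (Fin (n + 1)) K} :
    F ∈ vanishingIdeal X ↔ ∀ p ∈ X, VanishesAt F p :=
  Iff.rfl

theorem le_vanishingIdeal_zeroLocus (I : Ideal (MvPolynomial (Fin (n + 1)) K)) :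
    I ≤ vanishingIdeal (zeroLocus (I : Set (MvPolynomial (Fin (n + 1)) K))) :=
  fun F hF _ hp => hp F hF

/-- A polynomial that vanishes on a nonempty open subset of an irreducible set vanishes on the
whole set. -/
theorem mem_vanishingIdeal_of_isOpen [Infinite K] {X O : Set (ProjSpace K n)}
    (hX : IsIrreducible X) (hO : IsOpen O) (hXO : (X ∩ O).Nonempty)
    {F : MvPolynomial (Fin (n + 1)) K} (hF : ∀ p ∈ X ∩ O, VanishesAt F p) :
    F ∈ vanishingIdeal X := by
  by_contra h
  simp only [mem_vanishingIdeal, not_forall] at h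
  obtain ⟨p, hp, hFp⟩ := h
  obtain ⟨q, hqX, hqO, hq⟩ := hX.2 O (zeroLocus {F})ᶜ hO (isClosed_zeroLocus _).isOpen_compl hXO
    ⟨p, hp, fun h => hFp (h F rfl)⟩
  exact hq fun G hG => by
    rw [Set.mem_singleton_iff.1 hG]
    exact hF q ⟨hqX, hqO⟩

theorem isPrime_vanishingIdeal [Infinite K] {X : Set (ProjSpace K n)} (hX : IsIrreducible X) :
    (vanishingIdeal X).IsPrime := by
  refine ⟨fun h => ?_, fun {F G} hFG => ?_⟩
  · obtain ⟨p, hp⟩ := hX.1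
    have h1 : (1 : MvPolynomial (Fin (n + 1)) K) ∈ vanishingIdeal X := h ▸ Submodule.mem_top
    have := h1 p hp _ p.rep_nonzero p.mk_rep
    simp at this
  · by_cases hF : F ∈ vanishingIdeal X
    · exact Or.inl hF
    · simp only [mem_vanishingIdeal, not_forall] at hF
      obtain ⟨p, hp, hFp⟩ := hF
      refine Or.inr (mem_vanishingIdeal_of_isOpen hX (isClosed_zeroLocus {F}).isOpen_compl
        ⟨p, hp, fun h => hFp (h F rfl)⟩ fun q hq => ?_)
      refine (VanishesAt.mul_iff.1 (hFG q hq.1)).resolve_left fun h => hq.2 fun G hG => ?_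
      rw [Set.mem_singleton_iff.1 hG]
      exact h

end Points

section Kernel

/-! ### The kernel of the matrix of the linear elements -/

/-- Division by the basis leaves a remainder in `G` none of whose monomials is divisible by a
leading monomial of the basis; the Gröbner property forces it to be zero. -/
theorem IsGroebnerBasis.le_span {σ K : Type*} [Field K] {ord : MonomialOrder σ}
    {B : Finset (MvPolynomial σ K)} {G : Ideal (MvPolynomial σ K)}
    (hB : IsGroebnerBasis ord B G) : G ≤ Ideal.span (B : Set (MvPolynomial σ K)) := by
  intro F hF
  -- The basis may contain `0`, which is dropped because division needs invertible leading
  -- coefficients.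
  obtain ⟨q, r, hFr, -, hr⟩ := ord.div_set (B := {b | b ∈ B ∧ b ≠ 0})
    (fun b hb => (ord.leadingCoeff_ne_zero_iff.2 hb.2).isUnit) F
  have hq : ∀ J : Ideal (MvPolynomial σ K), (∀ b ∈ B, b ∈ J) →
      Finsupp.linearCombination _ (fun b : {b | b ∈ B ∧ b ≠ 0} => (b : MvPolynomial σ K)) q ∈ J :=
    fun J hJ => J.sum_mem fun b _ => J.mul_mem_left _ (hJ b b.2.1)
  have hrG : r ∈ G := by
    rw [← sub_eq_iff_eq_add'.2 hFr]
    exact G.sub_mem hF (hq G hB.1)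
  have hr0 : r = 0 := by
    by_contra h
    obtain ⟨b, hbB, hb0, hb⟩ := hB.2 r hrG h
    exact hr _ (ord.degree_mem_support h) b ⟨hbB, hb0⟩ hb
  rw [hFr, hr0, add_zero]
  exact hq _ fun b hb => Ideal.subset_span hb

variable {K : Type*} [Field K] {m n : ℕ} {X : Set (ProjSpace K m)}

/-- The tuples over the coordinate ring that are proportional to `(f₀, …, fₙ)`. -/
def proportionalTuples (X : Set (ProjSpace K m)) (f : Fin (n + 1) → MvPolynomial (Fin (m + 1)) K) :
    Submodule (CoordRing X) (Fin (n + 1) → CoordRing X) where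
  carrier := {g | ∀ i j, g i * Ideal.Quotient.mk (vanishingIdeal X) (f j) =
    g j * Ideal.Quotient.mk (vanishingIdeal X) (f i)}
  add_mem' := fun {a b} ha hb i j => by
    rw [Pi.add_apply, Pi.add_apply, add_mul, add_mul, ha i j, hb i j]
  zero_mem' := fun i j => by simp
  smul_mem' := fun c a ha i j => by
    rw [Pi.smul_apply, Pi.smul_apply, smul_mul_assoc, smul_mul_assoc, ha i j]

theorem mem_proportionalTuples {f : Fin (n + 1) → MvPolynomial (Fin (m + 1)) K}
    {g : Fin (n + 1) → CoordRing X} :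
    g ∈ proportionalTuples X f ↔ ∀ i j, g i * Ideal.Quotient.mk (vanishingIdeal X) (f j) =
      g j * Ideal.Quotient.mk (vanishingIdeal X) (f i) :=
  Iff.rfl

/-! ### Substituting tuples for the variables `x` -/

section Specialize

variable {A : Type*} [CommRing A]

/-- Evaluation of polynomials in `t` and `x` at the coordinate functions on `X` and at a tuple `y`
in an algebra over the coordinate ring. -/
def specialize (X : Set (ProjSpace K m)) [Algebra (CoordRing X) A] (y : Fin (n + 1) → A) :
    BiPoly K m n →+* A :=
  MvPolynomial.eval₂Hom ((algebraMap (CoordRing X) A).comp (algebraMap K (CoordRing X)))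
    (Sum.elim (fun i => algebraMap (CoordRing X) A
      (Ideal.Quotient.mk (vanishingIdeal X) (MvPolynomial.X i))) y)

variable [Algebra (CoordRing X) A]

theorem specialize_eq_aeval (y : Fin (n + 1) → A) (F : BiPoly K m n) :
    specialize X y F = MvPolynomial.aeval y (toCoordRingX X n F) := by
  have h : specialize X y =
      (MvPolynomial.aeval y : MvPolynomial (Fin (n + 1)) (CoordRing X) →ₐ[CoordRing X]
        A).toRingHom.comp (toCoordRingX X n).toRingHom := by
    refine MvPolynomial.ringHom_ext (fun c => ?_) (fun i => ?_)
    · have : algebraMap K (MvPolynomial (Fin (n + 1)) (CoordRing X)) c =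
        MvPolynomial.C (algebraMap K (CoordRing X) c) := rfl
      simp [specialize, toCoordRingX, this]
    · rcases i with i | i <;> simp [specialize, toCoordRingX]
  exact DFunLike.congr_fun h F

theorem specialize_inclT (y : Fin (n + 1) → A) (F : MvPolynomial (Fin (m + 1)) K) :
    specialize X y (inclT K m n F) =
      algebraMap (CoordRing X) A (Ideal.Quotient.mk (vanishingIdeal X) F) := by
  have h : (specialize X y).comp (inclT K m n).toRingHom =
      (algebraMap (CoordRing X) A).comp (Ideal.Quotient.mk (vanishingIdeal X)) := by
    refine MvPolynomial.ringHom_ext (fun c => ?_) (fun i => ?_)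
    · have : algebraMap K (CoordRing X) c =
        Ideal.Quotient.mk (vanishingIdeal X) (MvPolynomial.C c) := rfl
      simp [specialize, inclT, this]
    · simp [specialize, inclT]
  exact DFunLike.congr_fun h F

theorem specialize_X_inr (y : Fin (n + 1) → A) (j : Fin (n + 1)) :
    specialize X y (MvPolynomial.X (Sum.inr j) : BiPoly K m n) = y j := by
  simp [specialize]

theorem specialize_algebraMap (y : Fin (n + 1) → CoordRing X) (F : BiPoly K m n) :
    specialize X (fun j => algebraMap (CoordRing X) A (y j)) F =
      algebraMap (CoordRing X) A (specialize X y F) := by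
  have h : specialize X (fun j => algebraMap (CoordRing X) A (y j)) =
      (algebraMap (CoordRing X) A).comp (specialize X y : BiPoly K m n →+* _) :=
    MvPolynomial.ringHom_ext (fun c => by simp [specialize])
      (fun i => by rcases i with i | i <;> simp [specialize])
  exact DFunLike.congr_fun h F

theorem specialize_mul {r s : ℕ} {F : BiPoly K m n} (hF : IsBihomogeneous r s F) (c : A)
    (y : Fin (n + 1) → A) : specialize X (fun j => c * y j) F = c ^ s * specialize X y F := by
  simp only [specialize, MvPolynomial.coe_eval₂Hom, MvPolynomial.eval₂_eq']
  rw [Finset.mul_sum]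
  refine Finset.sum_congr rfl fun d hd => ?_
  rw [← (hF d hd).2]
  simp only [Fintype.prod_sum_type, Sum.elim_inl, Sum.elim_inr, mul_pow, Finset.prod_mul_distrib,
    Finset.prod_pow_eq_pow_sum]
  ring

theorem IsLinearMatrix.specialize_eq {B : Finset (BiPoly K m n)}
    {α : Matrix (LinearElements B) (Fin (n + 1)) (CoordRing X)} (hα : IsLinearMatrix X B α)
    (y : Fin (n + 1) → A) (b : LinearElements B) :
    specialize X y b.1 = ∑ j, algebraMap (CoordRing X) A (α b j) * y j := by
  rw [specialize_eq_aeval, ← hα b]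
  simp [Matrix.mulVec, dotProduct]

end Specialize

/-- The substitution `x = f` kills `I + J`. For `F` in the saturation it therefore kills `F * f_i ^
N`, and a nonzero `f_i` can be cancelled in the domain `R`. -/
theorem specialize_eq_zero_of_mem_graphIdeal {I : Ideal (MvPolynomial (Fin (m + 1)) K)}
    {f : Fin (n + 1) → MvPolynomial (Fin (m + 1)) K} (hI : I ≤ vanishingIdeal X)
    (hX : (vanishingIdeal X).IsPrime) (hf0 : ∃ i, f i ∉ vanishingIdeal X)
    {F : BiPoly K m n} (hF : F ∈ graphIdeal I f) :
    specialize X (fun j => Ideal.Quotient.mk (vanishingIdeal X) (f j)) F = 0 := by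
  set θ : BiPoly K m n →+* CoordRing X :=
    specialize X (fun j => Ideal.Quotient.mk (vanishingIdeal X) (f j)) with hθ
  have hle : I.map (inclT K m n) ⊔ minorsIdeal f ≤ RingHom.ker θ := by
    refine sup_le (Ideal.map_le_iff_le_comap.2 fun F hF => ?_) (Ideal.span_le.2 ?_)
    · rw [Ideal.mem_comap, RingHom.mem_ker]
      exact (specialize_inclT _ F).trans (Ideal.Quotient.eq_zero_iff_mem.2 (hI hF))
    · rintro _ ⟨i, j, rfl⟩
      rw [SetLike.mem_coe, RingHom.mem_ker, map_sub, map_mul, map_mul, hθ, specialize_inclT,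
        specialize_inclT, specialize_X_inr, specialize_X_inr, Algebra.algebraMap_self_apply,
        Algebra.algebraMap_self_apply]
      ring
  obtain ⟨i, hi⟩ := hf0
  obtain ⟨N, hN⟩ := hF
  have h := hle (hN (inclT K m n (f i)) (Ideal.subset_span ⟨i, rfl⟩))
  rw [RingHom.mem_ker, map_mul, map_pow, hθ, specialize_inclT] at h
  refine (mul_eq_zero.1 h).resolve_right fun h' => hi ?_
  exact Ideal.Quotient.eq_zero_iff_mem.1 (eq_zero_of_pow_eq_zero h')

theorem minor_mem_graphIdeal (I : Ideal (MvPolynomial (Fin (m + 1)) K))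
    (f : Fin (n + 1) → MvPolynomial (Fin (m + 1)) K) (i j : Fin (n + 1)) :
    MvPolynomial.X (Sum.inr i) * inclT K m n (f j) -
      MvPolynomial.X (Sum.inr j) * inclT K m n (f i) ∈ graphIdeal I f := by
  refine ⟨0, fun g _ => ?_⟩
  rw [pow_zero, mul_one]
  exact Ideal.mem_sup_right (Ideal.subset_span ⟨i, j, rfl⟩)

open scoped DualNumber in
theorem ker_eq_proportionalTuples {I : Ideal (MvPolynomial (Fin (m + 1)) K)}
    {f : Fin (n + 1) → MvPolynomial (Fin (m + 1)) K} (hI : I ≤ vanishingIdeal X)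
    (hX : (vanishingIdeal X).IsPrime) (hf0 : ∃ i, f i ∉ vanishingIdeal X)
    {ord : MonomialOrder (Fin (m + 1) ⊕ Fin (n + 1))} {B : Finset (BiPoly K m n)}
    (hB : IsGroebnerBasis ord B (graphIdeal I f))
    (hBhom : ∀ b ∈ B, ∃ r s : ℕ, IsBihomogeneous r s b)
    {α : Matrix (LinearElements B) (Fin (n + 1)) (CoordRing X)} (hα : IsLinearMatrix X B α) :
    LinearMap.ker α.mulVecLin = proportionalTuples X f := by
  have hθ : ∀ b ∈ B, specialize X (fun j => Ideal.Quotient.mk (vanishingIdeal X) (f j)) b = 0 :=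
    fun b hb => specialize_eq_zero_of_mem_graphIdeal hI hX hf0 (hB.1 b hb)
  ext g
  rw [LinearMap.mem_ker, Matrix.mulVecLin_apply, mem_proportionalTuples]
  constructor
  · intro hg
    let ψ : BiPoly K m n →+* (CoordRing X)[ε] :=
      specialize X (fun j => ε * algebraMap (CoordRing X) (CoordRing X)[ε] (g j))
    have hψ : ∀ b ∈ B, ψ b = 0 := by
      intro b hb
      obtain ⟨r, s, hrs⟩ := hBhom b hb
      have h := specialize_mul (X := X) hrs (ε : (CoordRing X)[ε])
        (fun j => algebraMap (CoordRing X) (CoordRing X)[ε] (g j))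
      match s, hrs with
      | 0, hrs =>
        -- In `x`-degree 0 the value is independent of the tuple: scaling by `0` identifies the
        -- value at `g` with the value at `f`, which is zero.
        have h1 := specialize_mul (X := X) hrs (0 : CoordRing X) g
        have h2 := specialize_mul (X := X) hrs (0 : CoordRing X)
          (fun j => Ideal.Quotient.mk (vanishingIdeal X) (f j))
        simp only [zero_mul, pow_zero, one_mul] at h1 h2
        refine h.trans ?_
        rw [specialize_algebraMap, ← h1, h2, hθ b hb, map_zero, mul_zero]
      | 1, hrs =>
        have h3 := hα.specialize_eq g ⟨b, hb, r, hrs⟩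
        refine h.trans ?_
        rw [specialize_algebraMap, h3]
        have h4 : ∑ j, α ⟨b, hb, r, hrs⟩ j * g j = 0 := congr_fun hg ⟨b, hb, r, hrs⟩
        simp only [Algebra.algebraMap_self_apply, h4, map_zero, mul_zero]
      | s + 2, hrs =>
        refine h.trans ?_
        rw [pow_add, DualNumber.eps_pow_two, mul_zero, zero_mul]
    have hker : graphIdeal I f ≤ RingHom.ker ψ :=
      hB.le_span.trans (Ideal.span_le.2 fun b hb => hψ b hb)
    intro i j
    have h := hker (minor_mem_graphIdeal I f i j)
    rw [RingHom.mem_ker, map_sub, map_mul, map_mul] at h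
    simp only [ψ, specialize_inclT, specialize_X_inr] at h
    have h' := congr_arg TrivSqZeroExt.snd h
    simpa [DualNumber.snd_mul, TrivSqZeroExt.algebraMap_eq_inl, sub_eq_zero] using h'
  · intro hg
    obtain ⟨k, hk⟩ := hf0
    funext b
    have h1 := hα.specialize_eq (fun j => Ideal.Quotient.mk (vanishingIdeal X) (f j)) b
    rw [hθ b.1 b.2.1] at h1
    simp only [Algebra.algebraMap_self_apply] at h1
    -- Proportionality turns `(∑ α_j g_j) f_k` into `(∑ α_j f_j) g_k`, which is zero.
    have h2 : (∑ j, α b j * g j) * Ideal.Quotient.mk (vanishingIdeal X) (f k) = 0 := by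
      rw [← zero_mul (g k), h1, Finset.sum_mul, Finset.sum_mul]
      refine Finset.sum_congr rfl fun j _ => ?_
      rw [mul_assoc, hg j k]
      ring
    exact (mul_eq_zero.1 h2).resolve_right fun h => hk (Ideal.Quotient.eq_zero_iff_mem.1 h)

end Kernel

/-! ### Morphisms given by homogeneous polynomials -/

section Tuples

variable {K : Type*} [Field K] {m n : ℕ}

/-- The values of the polynomials `G₀, …, Gₙ` at the chosen coordinates of the point `p`. -/
def evalTuple (G : Fin (n + 1) → MvPolynomial (Fin (m + 1)) K) (p : ProjSpace K m) :
    Fin (n + 1) → K :=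
  fun i => MvPolynomial.eval p.rep (G i)

theorem notMem_zeroLocus_range_iff {G : Fin (n + 1) → MvPolynomial (Fin (m + 1)) K} {e : ℕ}
    (hG : ∀ i, (G i).IsHomogeneous e) (p : ProjSpace K m) :
    p ∉ zeroLocus (Set.range G) ↔ evalTuple G p ≠ 0 :=
  (mem_zeroLocus_range_iff hG p).not

theorem mk_eq_mk_iff_mul_eq_mul {v w : Fin (n + 1) → K} (hv : v ≠ 0) (hw : w ≠ 0) :
    Projectivization.mk K v hv = Projectivization.mk K w hw ↔ ∀ i j, v i * w j = v j * w i := by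
  rw [Projectivization.mk_eq_mk_iff']
  constructor
  · rintro ⟨a, rfl⟩ i j
    simp only [Pi.smul_apply, smul_eq_mul]
    ring
  · intro h
    obtain ⟨k, hk⟩ := Function.ne_iff.1 hw
    refine ⟨v k / w k, funext fun i => ?_⟩
    rw [Pi.smul_apply, smul_eq_mul, div_mul_eq_mul_div, div_eq_iff hk, h k i]

theorem IsValueAt.mul_eq_mul {G H : Fin (n + 1) → MvPolynomial (Fin (m + 1)) K} {p : ProjSpace K m}
    {q : ProjSpace K n} (hG : IsValueAt G p q) (hH : IsValueAt H p q) (i j : Fin (n + 1)) :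
    evalTuple G p i * evalTuple H p j = evalTuple G p j * evalTuple H p i := by
  obtain ⟨h, rfl⟩ := hG
  obtain ⟨h', e⟩ := hH
  exact (mk_eq_mk_iff_mul_eq_mul h h').1 e.symm i j

theorem IsValueAt.of_mul_eq_mul {G H : Fin (n + 1) → MvPolynomial (Fin (m + 1)) K}
    {p : ProjSpace K m} {q : ProjSpace K n} (hG : IsValueAt G p q) (hH : evalTuple H p ≠ 0)
    (h : ∀ i j, evalTuple G p i * evalTuple H p j = evalTuple G p j * evalTuple H p i) :
    IsValueAt H p q := by
  obtain ⟨hG, rfl⟩ := hG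
  exact ⟨hH, ((mk_eq_mk_iff_mul_eq_mul hG hH).2 h).symm⟩

theorem eval_rep_aeval (G : Fin (n + 1) → MvPolynomial (Fin (m + 1)) K) (p : ProjSpace K m)
    (F : MvPolynomial (Fin (n + 1)) K) :
    MvPolynomial.eval p.rep (MvPolynomial.aeval G F) = MvPolynomial.eval (evalTuple G p) F := by
  have h : (MvPolynomial.eval p.rep).comp
      (MvPolynomial.aeval G : MvPolynomial (Fin (n + 1)) K →ₐ[K] _).toRingHom =
      MvPolynomial.eval (evalTuple G p) := by
    ext i <;> simp [evalTuple]
  exact DFunLike.congr_fun h F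

theorem IsValueAt.exists_rep_eq_smul {G : Fin (n + 1) → MvPolynomial (Fin (m + 1)) K}
    {p : ProjSpace K m} {q : ProjSpace K n} (h : IsValueAt G p q) :
    ∃ a : K, a ≠ 0 ∧ q.rep = a • evalTuple G p := by
  obtain ⟨h, rfl⟩ := h
  obtain ⟨a, ha⟩ := Projectivization.exists_smul_eq_mk_rep K _ h
  exact ⟨a, a.ne_zero, ha.symm⟩

/-- The chosen coordinates of `q` are only a multiple of the values of `G`. The resulting factor is
the same for all forms of degree `d`, so it cancels in quotients. -/
theorem IsValueAt.exists_eval_rep_eq {G : Fin (n + 1) → MvPolynomial (Fin (m + 1)) K}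
    {p : ProjSpace K m} {q : ProjSpace K n} (h : IsValueAt G p q) (d : ℕ) :
    ∃ a : K, a ≠ 0 ∧ ∀ F : MvPolynomial (Fin (n + 1)) K, F.IsHomogeneous d →
      MvPolynomial.eval q.rep F = a * MvPolynomial.eval p.rep (MvPolynomial.aeval G F) := by
  obtain ⟨a, ha, hq⟩ := h.exists_rep_eq_smul
  refine ⟨a ^ d, pow_ne_zero d ha, fun F hF => ?_⟩
  rw [hq, eval_smul_of_isHomogeneous hF, eval_rep_aeval]

/-- A map that is given locally by homogeneous polynomials of one degree without common zeros is a
morphism. -/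
theorem isMorphismOn_of_forall_exists [Infinite K] {U : Set (ProjSpace K m)}
    {φ : ProjSpace K m → ProjSpace K n}
    (h : ∀ p ∈ U, ∃ (e : ℕ) (G : Fin (n + 1) → MvPolynomial (Fin (m + 1)) K),
      (∀ i, (G i).IsHomogeneous e) ∧ p ∉ zeroLocus (Set.range G) ∧
        ∀ q ∈ U, q ∉ zeroLocus (Set.range G) → IsValueAt G q (φ q)) :
    IsMorphismOn U φ := by
  have hcont : ContinuousOn φ U := by
    refine continuousOn_to_generateFrom_iff.2 ?_
    rintro p hp _ ⟨d, F, hF, rfl⟩ hpF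
    obtain ⟨e, G, hG, hpG, hval⟩ := h p hp
    have hFG : (MvPolynomial.aeval G F).IsHomogeneous (e * d) := hF.aeval G hG
    have key : ∀ q ∈ U, q ∉ zeroLocus (Set.range G) →
        (φ q ∈ (zeroLocus {F})ᶜ ↔ q ∈ (zeroLocus {MvPolynomial.aeval G F})ᶜ) := by
      intro q hq hqG
      obtain ⟨a, ha, hev⟩ := (hval q hq hqG).exists_eval_rep_eq d
      simp only [zeroLocus, Set.mem_compl_iff, Set.mem_ofPred_eq, Set.mem_singleton_iff, forall_eq,
        vanishesAt_iff_of_isHomogeneous hF, vanishesAt_iff_of_isHomogeneous hFG, hev F hF,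
        mul_eq_zero, ha, false_or]
    refine mem_nhdsWithin.2 ⟨(zeroLocus (Set.range G))ᶜ ∩ (zeroLocus {MvPolynomial.aeval G F})ᶜ,
      (isClosed_zeroLocus _).isOpen_compl.inter (isClosed_zeroLocus _).isOpen_compl,
      ⟨hpG, (key p hp hpG).1 hpF⟩, fun q hq => (key q hq.2 hq.1.1).2 hq.1.2⟩
  refine ⟨hcont, fun V k _ hk p hp => ?_⟩
  obtain ⟨W, hW, hpW, d, A, B, hA, hB, hAB⟩ := hk (φ p) hp.2
  obtain ⟨e, G, hG, hpG, hval⟩ := h p hp.1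
  obtain ⟨O, hO, hpO, hOW⟩ := mem_nhdsWithin.1 (hcont p hp.1 (hW.mem_nhds hpW))
  refine ⟨O ∩ (zeroLocus (Set.range G))ᶜ, hO.inter (isClosed_zeroLocus _).isOpen_compl, ⟨hpO, hpG⟩,
    e * d, MvPolynomial.aeval G A, MvPolynomial.aeval G B, hA.aeval G hG, hB.aeval G hG, ?_⟩
  rintro q ⟨⟨hqU, hqV⟩, hqO, hqG⟩
  obtain ⟨hB0, hkq⟩ := hAB (φ q) ⟨hqV, hOW ⟨hqO, hqU⟩⟩
  obtain ⟨a, ha, hev⟩ := (hval q hqU hqG).exists_eval_rep_eq d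
  rw [hev B hB] at hB0 hkq
  rw [hev A hA, mul_div_mul_left _ _ ha] at hkq
  exact ⟨right_ne_zero_of_mul hB0, hkq⟩

/-- Locally a morphism to projective space is given by homogeneous polynomials of one degree. -/
theorem IsMorphismOn.exists_isValueAt {U : Set (ProjSpace K m)} {φ : ProjSpace K m → ProjSpace K n}
    (hφ : IsMorphismOn U φ) {p : ProjSpace K m} (hp : p ∈ U) :
    ∃ O : Set (ProjSpace K m), IsOpen O ∧ p ∈ O ∧
      ∃ (e : ℕ) (G : Fin (n + 1) → MvPolynomial (Fin (m + 1)) K), (∀ i, (G i).IsHomogeneous e) ∧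
        ∀ q ∈ U ∩ O, IsValueAt G q (φ q) := by
  -- Work in the affine chart `x_j ≠ 0` around `φ p`: the pullbacks of the regular functions `x_i /
  -- x_j` are locally fractions `A_i / B_i`.
  obtain ⟨j, hj⟩ := Function.ne_iff.1 (φ p).rep_nonzero
  rw [Pi.zero_apply] at hj
  set V : Set (ProjSpace K n) := (zeroLocus {MvPolynomial.X j})ᶜ with hV
  have hVo : IsOpen V := isOpen_compl_zeroLocus_singleton (MvPolynomial.isHomogeneous_X K j)
  have hmem : ∀ q, q ∈ V ↔ q.rep j ≠ 0 := fun q => by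
    simp [hV, zeroLocus, vanishesAt_iff_of_isHomogeneous (MvPolynomial.isHomogeneous_X K j)]
  have hreg : ∀ i, IsRegularOn V fun q => q.rep i / q.rep j := fun i q hq =>
    ⟨V, hVo, hq, 1, MvPolynomial.X i, MvPolynomial.X j, MvPolynomial.isHomogeneous_X K i,
      MvPolynomial.isHomogeneous_X K j, fun r hr => by simpa using (hmem r).1 hr.1⟩
  choose W hWo hpW d A B hA hB hAB using fun i =>
    hφ.2 V _ hVo (hreg i) p ⟨hp, (hmem _).2 hj⟩
  obtain ⟨O, hO, hpO, hOV⟩ := mem_nhdsWithin.1 (hφ.1 p hp (hVo.mem_nhds ((hmem _).2 hj)))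
  -- Clearing denominators in the `A_i / B_i` gives forms of the common degree `∑ d_i`.
  refine ⟨O ∩ ⋂ i, W i, hO.inter (isOpen_iInter_of_finite hWo), ⟨hpO, Set.mem_iInter.2 hpW⟩,
    ∑ i, d i, fun i => A i * ∏ k ∈ Finset.univ.erase i, B k, fun i => ?_, ?_⟩
  · rw [← Finset.add_sum_erase _ _ (Finset.mem_univ i)]
    exact (hA i).mul (MvPolynomial.IsHomogeneous.prod _ _ _ fun k _ => hB k)
  · rintro q ⟨hqU, hqO, hqW⟩
    have hqV : q ∈ φ ⁻¹' V := hOV ⟨hqO, hqU⟩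
    have hq := fun i => hAB i q ⟨⟨hqU, hqV⟩, Set.mem_iInter.1 hqW i⟩
    have hj0 : (φ q).rep j ≠ 0 := (hmem _).1 hqV
    have hB0 : ∏ k, MvPolynomial.eval q.rep (B k) ≠ 0 :=
      Finset.prod_ne_zero_iff.2 fun k _ => (hq k).1
    have hev : (fun i => MvPolynomial.eval q.rep (A i * ∏ k ∈ Finset.univ.erase i, B k)) =
        ((∏ k, MvPolynomial.eval q.rep (B k)) / (φ q).rep j) • (φ q).rep := by
      funext i
      have h1 := (hq i).2
      rw [Function.comp_apply, eq_div_iff (hq i).1] at h1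
      rw [map_mul, map_prod, ← h1, Pi.smul_apply, smul_eq_mul,
        ← Finset.mul_prod_erase _ _ (Finset.mem_univ i)]
      ring
    have hne : (∏ k, MvPolynomial.eval q.rep (B k)) / (φ q).rep j ≠ 0 := div_ne_zero hB0 hj0
    refine ⟨hev ▸ smul_ne_zero hne (φ q).rep_nonzero, ?_⟩
    conv_rhs => rw [← (φ q).mk_rep]
    rw [Projectivization.mk_eq_mk_iff']
    exact ⟨_, hev.symm⟩

end Tuples

/-! ### Representatives of a rational map -/

section Representatives

variable {K : Type*} [Field K] {m n : ℕ} {X : Set (ProjSpace K m)}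
  {f : Fin (n + 1) → MvPolynomial (Fin (m + 1)) K}

/-- `G` consists of homogeneous polynomials of one degree whose classes are proportional to `f`. -/
def IsHomogeneousProportional (X : Set (ProjSpace K m))
    (f G : Fin (n + 1) → MvPolynomial (Fin (m + 1)) K) : Prop :=
  (∃ e : ℕ, ∀ i, (G i).IsHomogeneous e) ∧
    (fun i => Ideal.Quotient.mk (vanishingIdeal X) (G i)) ∈ proportionalTuples X f

theorem mk_mem_proportionalTuples_iff {G : Fin (n + 1) → MvPolynomial (Fin (m + 1)) K} :
    (fun i => Ideal.Quotient.mk (vanishingIdeal X) (G i)) ∈ proportionalTuples X f ↔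
      ∀ i j, G i * f j - G j * f i ∈ vanishingIdeal X := by
  simp only [mem_proportionalTuples, ← map_mul, Ideal.Quotient.eq]

/-- The module is graded: all `f_j` have degree `d`, so the part of degree `e + d` of `G_i f_j - G_j
f_i` involves only the components of `G` of degree `e`. -/
theorem homogeneousComponent_isHomogeneousProportional [Infinite K] {d : ℕ}
    (hf : ∀ i, (f i).IsHomogeneous d)
    {G : Fin (n + 1) → MvPolynomial (Fin (m + 1)) K}
    (hG : (fun i => Ideal.Quotient.mk (vanishingIdeal X) (G i)) ∈ proportionalTuples X f) (e : ℕ) :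
    IsHomogeneousProportional X f fun i => MvPolynomial.homogeneousComponent e (G i) := by
  refine ⟨⟨e, fun i => MvPolynomial.homogeneousComponent_isHomogeneous e (G i)⟩, ?_⟩
  rw [mk_mem_proportionalTuples_iff] at hG ⊢
  intro i j p hp
  have hhom : ∀ i j, (MvPolynomial.homogeneousComponent e (G i) * f j).IsHomogeneous (e + d) :=
    fun i j => (MvPolynomial.homogeneousComponent_isHomogeneous e (G i)).mul (hf j)
  rw [vanishesAt_iff_of_isHomogeneous ((hhom i j).sub (hhom j i))]
  have h := congr_arg (fun P => P.coeff (e + d)) ((vanishesAt_iff _ p).1 (hG i j p hp))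
  simp only [map_sub, map_mul, lineHom_of_isHomogeneous _ (hf _), Polynomial.coeff_sub,
    ← mul_assoc, Polynomial.coeff_mul_X_pow, Polynomial.coeff_mul_C, coeff_lineHom,
    Polynomial.coeff_zero] at h
  simpa only [map_sub, map_mul] using h

/-- Two tuples proportional to `f` are proportional to each other, because `f_k ^ 2` can be
cancelled in the domain `R`. This makes the gluing well defined, even at common zeros of `f`. -/
theorem IsHomogeneousProportional.mul_eq_mul (hX : (vanishingIdeal X).IsPrime)
    (hf0 : ∃ i, f i ∉ vanishingIdeal X) {G H : Fin (n + 1) → MvPolynomial (Fin (m + 1)) K}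
    (hG : IsHomogeneousProportional X f G) (hH : IsHomogeneousProportional X f H)
    {p : ProjSpace K m} (hp : p ∈ X) (i j : Fin (n + 1)) :
    evalTuple G p i * evalTuple H p j = evalTuple G p j * evalTuple H p i := by
  obtain ⟨k, hk⟩ := hf0
  have h : G i * H j - G j * H i ∈ vanishingIdeal X := by
    have h1 := hG.2
    have h2 := hH.2
    rw [mem_proportionalTuples] at h1 h2
    have hk' : Ideal.Quotient.mk (vanishingIdeal X) (f k) ≠ 0 :=
      fun h => hk (Ideal.Quotient.eq_zero_iff_mem.1 h)
    rw [← Ideal.Quotient.eq, map_mul, map_mul]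
    refine mul_right_cancel₀ (mul_ne_zero hk' hk') ?_
    linear_combination
      Ideal.Quotient.mk (vanishingIdeal X) (f k) * Ideal.Quotient.mk _ (H j) * h1 i k +
      Ideal.Quotient.mk (vanishingIdeal X) (f i) * Ideal.Quotient.mk _ (G k) * h2 j k -
      Ideal.Quotient.mk (vanishingIdeal X) (f k) * Ideal.Quotient.mk _ (H i) * h1 j k -
      Ideal.Quotient.mk (vanishingIdeal X) (f j) * Ideal.Quotient.mk _ (G k) * h2 i k
  have h' := h p hp _ p.rep_nonzero p.mk_rep
  rw [map_sub, map_mul, map_mul, sub_eq_zero] at h'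
  exact h'

/-- Homogeneous polynomials that describe a morphism of the class of `f` on a nonempty open subset
of `X` are proportional to `f`. -/
theorem isHomogeneousProportional_of_isValueAt [Infinite K] (hX : IsIrreducible X) {d : ℕ}
    (hf : ∀ i, (f i).IsHomogeneous d) {G : Fin (n + 1) → MvPolynomial (Fin (m + 1)) K}
    (hG : ∃ e : ℕ, ∀ i, (G i).IsHomogeneous e) {O : Set (ProjSpace K m)} (hO : IsOpen O)
    (hXO : (X ∩ O).Nonempty) {φ : ProjSpace K m → ProjSpace K n}
    (hφG : ∀ p ∈ X ∩ O, IsValueAt G p (φ p))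
    (hφf : ∀ p ∈ X ∩ O, p ∉ zeroLocus (Set.range f) → IsValueAt f p (φ p)) :
    IsHomogeneousProportional X f G := by
  refine ⟨hG, mk_mem_proportionalTuples_iff.2 fun i j => ?_⟩
  obtain ⟨e, hG⟩ := hG
  refine mem_vanishingIdeal_of_isOpen hX hO hXO fun p hp => ?_
  rw [vanishesAt_iff_of_isHomogeneous (((hG i).mul (hf j)).sub ((hG j).mul (hf i))), map_sub,
    map_mul, map_mul, sub_eq_zero]
  -- At common zeros of `f` nothing is known about `φ` relative to `f`, but both products vanish
  -- there.
  by_cases hpf : p ∈ zeroLocus (Set.range f)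
  · have h := (mem_zeroLocus_range_iff hf p).1 hpf
    have hi : MvPolynomial.eval p.rep (f i) = 0 := congr_fun h i
    have hj : MvPolynomial.eval p.rep (f j) = 0 := congr_fun h j
    rw [hi, hj, mul_zero, mul_zero]
  · exact (hφG p hp).mul_eq_mul (hφf p hp hpf) i j

theorem isHomogeneousProportional_self {d : ℕ} (hf : ∀ i, (f i).IsHomogeneous d) :
    IsHomogeneousProportional X f f :=
  ⟨⟨d, hf⟩, fun _ _ => mul_comm _ _⟩

/-- The homogeneous tuples that are proportional to `f` glue to a morphism of the class of `f`. -/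
theorem exists_inClass [Infinite K] (hX : IsIrreducible X) {d : ℕ}
    (hf : ∀ i, (f i).IsHomogeneous d)
    (hf0 : ∃ i, f i ∉ vanishingIdeal X) {U O : Set (ProjSpace K m)} (hU : U.Nonempty)
    (hO : IsOpen O) (hUO : U = X ∩ O)
    (h : ∀ p ∈ U, ∃ G, IsHomogeneousProportional X f G ∧ p ∉ zeroLocus (Set.range G)) :
    ∃ φ : ProjSpace K m → ProjSpace K n, InClass X f U φ ∧ ∀ p ∈ U, ∀ G,
      IsHomogeneousProportional X f G → p ∉ zeroLocus (Set.range G) → IsValueAt G p (φ p) := by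
  have hP := isPrime_vanishingIdeal hX
  have hUX : U ⊆ X := hUO ▸ Set.inter_subset_left
  have hval : ∀ p, ∃ q : ProjSpace K n, p ∈ U → ∀ G, IsHomogeneousProportional X f G →
      p ∉ zeroLocus (Set.range G) → IsValueAt G p q := by
    intro p
    by_cases hp : p ∈ U
    · obtain ⟨G, hG, hpG⟩ := h p hp
      obtain ⟨e, he⟩ := hG.1
      refine ⟨_, fun _ H hH hpH => IsValueAt.of_mul_eq_mul
        ⟨(notMem_zeroLocus_range_iff he p).1 hpG, rfl⟩ ?_ (hG.mul_eq_mul hP hf0 hH (hUX hp))⟩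
      obtain ⟨e', he'⟩ := hH.1
      exact (notMem_zeroLocus_range_iff he' p).1 hpH
    -- Outside `U` the value is arbitrary; `(1 : … : 1)` is used.
    · exact ⟨Projectivization.mk K (fun _ => 1) (Function.ne_iff.2 ⟨0, one_ne_zero⟩),
        fun h => absurd h hp⟩
  choose φ hφ using hval
  refine ⟨φ, ⟨hU, ⟨O, hO, hUO⟩, isMorphismOn_of_forall_exists fun p hp => ?_, fun p hp =>
    hφ p hp.1 f (isHomogeneousProportional_self hf) hp.2⟩, hφ⟩
  obtain ⟨G, hG, hpG⟩ := h p hp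
  obtain ⟨e, he⟩ := hG.1
  exact ⟨e, G, he, hpG, fun q hq hqG => hφ q hq G hG hqG⟩

theorem isRepresentative_iff [Infinite K] (hX : IsIrreducible X) {d : ℕ}
    (hf : ∀ i, (f i).IsHomogeneous d)
    (hf0 : ∃ i, f i ∉ vanishingIdeal X) (g : Fin (n + 1) → CoordRing X) :
    IsRepresentative X f g ↔
      g ∈ proportionalTuples X f ∧ g ≠ 0 ∧ ∃ G, IsHomogeneousLift X g G := by
  constructor
  · rintro ⟨G, hG, φ, hφ, hval⟩
    have h := isHomogeneousProportional_of_isValueAt hX hf hG.1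
      (isClosed_zeroLocus (Set.range G)).isOpen_compl hφ.1 (φ := φ) hval
      fun p hp hpf => hφ.2.2.2 p ⟨hp, hpf⟩
    have hg : (fun i => Ideal.Quotient.mk (vanishingIdeal X) (G i)) = g := funext hG.2
    refine ⟨hg ▸ h.2, fun h0 => ?_, G, hG⟩
    obtain ⟨p, hp, hpG⟩ := hφ.1
    refine hpG ?_
    rintro _ ⟨i, rfl⟩
    have hi := hG.2 i
    rw [h0, Pi.zero_apply, Ideal.Quotient.eq_zero_iff_mem] at hi
    exact hi p hp
  · rintro ⟨hg, hg0, G, hG⟩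
    have hg' : (fun i => Ideal.Quotient.mk (vanishingIdeal X) (G i)) = g := funext hG.2
    have hGp : IsHomogeneousProportional X f G := ⟨hG.1, hg' ▸ hg⟩
    have hne : (X \ zeroLocus (Set.range G)).Nonempty := by
      obtain ⟨i, hi⟩ := Function.ne_iff.1 hg0
      rw [← hG.2 i, Pi.zero_apply, Ne, Ideal.Quotient.eq_zero_iff_mem, mem_vanishingIdeal] at hi
      push Not at hi
      obtain ⟨p, hp, hpi⟩ := hi
      exact ⟨p, hp, fun h => hpi (h _ ⟨i, rfl⟩)⟩
    obtain ⟨φ, hφ, hval⟩ := exists_inClass hX hf hf0 hne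
      (isClosed_zeroLocus (Set.range G)).isOpen_compl rfl fun p hp => ⟨G, hGp, hp.2⟩
    exact ⟨G, hG, φ, hφ, fun p hp => hval p hp G hGp hp.2⟩

theorem proportionalTuples_eq_span [Infinite K] (hX : IsIrreducible X) {d : ℕ}
    (hf : ∀ i, (f i).IsHomogeneous d) (hf0 : ∃ i, f i ∉ vanishingIdeal X) :
    proportionalTuples X f = Submodule.span (CoordRing X) {g | IsRepresentative X f g} := by
  refine le_antisymm (fun g hg => ?_)
    (Submodule.span_le.2 fun g hg => ((isRepresentative_iff hX hf hf0 g).1 hg).1)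
  choose G hG using fun i => Ideal.Quotient.mk_surjective (I := vanishingIdeal X) (g i)
  have hg' : (fun i => Ideal.Quotient.mk (vanishingIdeal X) (G i)) = g := funext hG
  -- A bound on all degrees lets the entries be split into components over one common index range.
  obtain ⟨N, hN⟩ : ∃ N, ∀ i, (G i).totalDegree < N :=
    ⟨Finset.univ.sup (fun i => (G i).totalDegree) + 1, fun i => Nat.lt_succ_of_le
      (Finset.le_sup (f := fun i => (G i).totalDegree) (Finset.mem_univ i))⟩
  have hsum : g = ∑ e ∈ Finset.range N, fun i =>
      Ideal.Quotient.mk (vanishingIdeal X) (MvPolynomial.homogeneousComponent e (G i)) := by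
    funext i
    rw [Finset.sum_apply, ← map_sum, ← hG i]
    congr 1
    conv_lhs => rw [← MvPolynomial.sum_homogeneousComponent (G i)]
    refine Finset.sum_subset (Finset.range_subset_range.2 (hN i)) fun e _ he => ?_
    exact MvPolynomial.homogeneousComponent_eq_zero _ _ (by simpa using he)
  rw [hsum]
  refine Submodule.sum_mem _ fun e _ => ?_
  have he := homogeneousComponent_isHomogeneousProportional hf (hg' ▸ hg) e
  by_cases h0 : (fun i => Ideal.Quotient.mk (vanishingIdeal X)
      (MvPolynomial.homogeneousComponent e (G i))) = 0
  · rw [h0]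
    exact Submodule.zero_mem _
  · exact Submodule.subset_span ((isRepresentative_iff hX hf hf0 _).2
      ⟨he.2, h0, _, he.1, fun i => rfl⟩)

/-! ### The domain of definition -/

/-- As `p` lies in `X`, vanishing at `p` depends only on the class in `R`, and the classes vanishing
at `p` form an ideal of `R`. -/
theorem mk_mem_map_vanishingIdeal_singleton {p : ProjSpace K m} (hp : p ∈ X)
    (F : MvPolynomial (Fin (m + 1)) K) :
    Ideal.Quotient.mk (vanishingIdeal X) F ∈
      (vanishingIdeal {p}).map (Ideal.Quotient.mk (vanishingIdeal X)) ↔ VanishesAt F p := by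
  have h : vanishingIdeal X ≤ vanishingIdeal {p} := fun F hF q hq =>
    hF q (Set.mem_singleton_iff.1 hq ▸ hp)
  rw [← Ideal.mem_comap, Ideal.comap_map_mk h, mem_vanishingIdeal]
  simp

/-- The columns of `β` generate the module, and vanishing at `p` passes to `R`-linear combinations;
hence the locus does not depend on the choice of `β`. -/
theorem mem_iInter_zeroLocus_iff {k : ℕ} {β : Matrix (Fin (n + 1)) (Fin k) (CoordRing X)}
    (hβ : LinearMap.range β.mulVecLin = proportionalTuples X f) {p : ProjSpace K m} (hp : p ∈ X) :
    p ∈ ⋂ l : Fin k, zeroLocus ((Ideal.span (Set.range fun i => β i l)).comap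
        (Ideal.Quotient.mk (vanishingIdeal X)) : Set (MvPolynomial (Fin (m + 1)) K)) ↔
      ∀ G : Fin (n + 1) → MvPolynomial (Fin (m + 1)) K,
        (fun i => Ideal.Quotient.mk (vanishingIdeal X) (G i)) ∈ proportionalTuples X f →
          ∀ i, VanishesAt (G i) p := by
  have hmem := fun F => mk_mem_map_vanishingIdeal_singleton hp F
  set P : Ideal (CoordRing X) := (vanishingIdeal {p}).map (Ideal.Quotient.mk (vanishingIdeal X))
  rw [Set.mem_iInter]
  constructor
  · intro h G hG i
    have hβP : ∀ i l, β i l ∈ P := fun i l => by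
      obtain ⟨F, hF⟩ := Ideal.Quotient.mk_surjective (I := vanishingIdeal X) (β i l)
      rw [← hF, hmem]
      refine h l F ?_
      rw [SetLike.mem_coe, Ideal.mem_comap, hF]
      exact Ideal.subset_span ⟨i, rfl⟩
    rw [← hβ] at hG
    obtain ⟨c, hc⟩ := hG
    rw [← hmem]
    have hi : ∑ l, β i l * c l = Ideal.Quotient.mk (vanishingIdeal X) (G i) := congr_fun hc i
    rw [← hi]
    exact P.sum_mem fun l _ => P.mul_mem_right _ (hβP i l)
  · intro h l F hF
    have hβl : (fun i => β i l) ∈ proportionalTuples X f := by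
      rw [← hβ]
      exact ⟨Pi.single l 1, Matrix.mulVec_single_one β l⟩
    rw [← hmem]
    refine Ideal.span_le.2 ?_ (show _ ∈ Ideal.span (Set.range fun i => β i l) from hF)
    rintro _ ⟨i, rfl⟩
    choose G hG using fun i => Ideal.Quotient.mk_surjective (I := vanishingIdeal X) (β i l)
    have hG' : (fun i => Ideal.Quotient.mk (vanishingIdeal X) (G i)) = fun i => β i l := funext hG
    rw [SetLike.mem_coe]
    beta_reduce
    rw [← hG i, hmem]
    exact h G (hG' ▸ hβl) i

theorem notMem_iInter_zeroLocus_iff [Infinite K] {d : ℕ} (hf : ∀ i, (f i).IsHomogeneous d) {k : ℕ}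
    {β : Matrix (Fin (n + 1)) (Fin k) (CoordRing X)}
    (hβ : LinearMap.range β.mulVecLin = proportionalTuples X f) {p : ProjSpace K m} (hp : p ∈ X) :
    p ∉ ⋂ l : Fin k, zeroLocus ((Ideal.span (Set.range fun i => β i l)).comap
        (Ideal.Quotient.mk (vanishingIdeal X)) : Set (MvPolynomial (Fin (m + 1)) K)) ↔
      ∃ G, IsHomogeneousProportional X f G ∧ p ∉ zeroLocus (Set.range G) := by
  rw [mem_iInter_zeroLocus_iff hβ hp]
  constructor
  · intro h
    push Not at h
    obtain ⟨G, hG, i, hi⟩ := h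
    rw [vanishesAt_iff_homogeneousComponent] at hi
    push Not at hi
    obtain ⟨e, he⟩ := hi
    refine ⟨_, homogeneousComponent_isHomogeneousProportional hf hG e, fun h => he ?_⟩
    exact h _ ⟨i, rfl⟩ _ p.rep_nonzero p.mk_rep
  · rintro ⟨G, hG, hpG⟩ h
    refine hpG ?_
    rintro _ ⟨i, rfl⟩
    exact h G hG.2 i

theorem isDomainOfDefinition [Infinite K] (hX : IsIrreducible X) {d : ℕ}
    (hf : ∀ i, (f i).IsHomogeneous d)
    (hf0 : ∃ i, f i ∉ vanishingIdeal X) {k : ℕ}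
    {β : Matrix (Fin (n + 1)) (Fin k) (CoordRing X)}
    (hβ : LinearMap.range β.mulVecLin = proportionalTuples X f) :
    IsDomainOfDefinition X f
      (X \ ⋂ l : Fin k, zeroLocus ((Ideal.span (Set.range fun i => β i l)).comap
        (Ideal.Quotient.mk (vanishingIdeal X)) : Set (MvPolynomial (Fin (m + 1)) K))) := by
  constructor
  · have hne : (X \ ⋂ l : Fin k, zeroLocus ((Ideal.span (Set.range fun i => β i l)).comap
        (Ideal.Quotient.mk (vanishingIdeal X)) : Set (MvPolynomial (Fin (m + 1)) K))).Nonempty := by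
      obtain ⟨i, hi⟩ := hf0
      simp only [mem_vanishingIdeal, not_forall] at hi
      obtain ⟨p, hp, hpi⟩ := hi
      exact ⟨p, hp, (notMem_iInter_zeroLocus_iff hf hβ hp).2
        ⟨f, isHomogeneousProportional_self hf, fun h => hpi (h _ ⟨i, rfl⟩)⟩⟩
    obtain ⟨φ, hφ, -⟩ := exists_inClass hX hf hf0 hne
      (isClosed_iInter fun l => isClosed_zeroLocus _).isOpen_compl rfl
      fun p hp => (notMem_iInter_zeroLocus_iff hf hβ hp.1).1 hp.2
    exact ⟨φ, hφ⟩
  -- Maximality: near any point of `U` the morphism is given by a homogeneous tuple that is nonzero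
  -- at that point, and this tuple is proportional to `f`.
  · rintro U ⟨φ, -, ⟨O, hO, rfl⟩, hφ, hφf⟩ p hp
    obtain ⟨O', hO', hpO', e, G, hG, hval⟩ := hφ.exists_isValueAt hp
    refine ⟨hp.1, (notMem_iInter_zeroLocus_iff hf hβ hp.1).2 ⟨G, ?_, ?_⟩⟩
    · refine isHomogeneousProportional_of_isValueAt hX hf ⟨e, hG⟩ (hO.inter hO')
        ⟨p, hp.1, hp.2, hpO'⟩ (φ := φ) (fun q hq => hval q ⟨⟨hq.1, hq.2.1⟩, hq.2.2⟩)
        fun q hq hqf => hφf q ⟨⟨hq.1, hq.2.1⟩, hqf⟩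
    · obtain ⟨h, -⟩ := hval p ⟨hp, hpO'⟩
      exact (notMem_zeroLocus_range_iff hG p).2 h

end Representatives

end RationalMapDomain

end

theorem mainTheorem4 {K : Type*} [Field K] [IsAlgClosed K] {m n : ℕ}
    (I : Ideal (MvPolynomial (Fin (m + 1)) K))
    (hI : ∀ F ∈ I, ∀ e : ℕ, MvPolynomial.homogeneousComponent e F ∈ I)
    (X : Set (RationalMapDomain.ProjSpace K m))
    (hX : X = RationalMapDomain.zeroLocus (I : Set (MvPolynomial (Fin (m + 1)) K)))
    (hirr : IsIrreducible X)
    (f : Fin (n + 1) → MvPolynomial (Fin (m + 1)) K)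
    (d : ℕ) (hf : ∀ i, (f i).IsHomogeneous d)
    (hf0 : ∃ i, f i ∉ RationalMapDomain.vanishingIdeal X)
    (ord : MonomialOrder (Fin (m + 1) ⊕ Fin (n + 1)))
    (B : Finset (RationalMapDomain.BiPoly K m n))
    (hB : RationalMapDomain.IsGroebnerBasis ord B (RationalMapDomain.graphIdeal I f))
    (hBhom : ∀ b ∈ B, ∃ r s : ℕ, RationalMapDomain.IsBihomogeneous r s b)
    (α : Matrix (RationalMapDomain.LinearElements B) (Fin (n + 1))
      (RationalMapDomain.CoordRing X))
    (hα : RationalMapDomain.IsLinearMatrix X B α) :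
    -- the representatives are the nonzero homogeneous vectors of `ker α`
    (∀ g : Fin (n + 1) → RationalMapDomain.CoordRing X,
      RationalMapDomain.IsRepresentative X f g ↔
        g ∈ LinearMap.ker α.mulVecLin ∧ g ≠ 0 ∧
          ∃ G, RationalMapDomain.IsHomogeneousLift X g G) ∧
    -- `ker α` is the `R`-module of the representatives
    LinearMap.ker α.mulVecLin =
      Submodule.span (RationalMapDomain.CoordRing X)
        {g | RationalMapDomain.IsRepresentative X f g} ∧
    -- `ker α` consists of all tuples which are proportional to `(f₀, …, fₙ)` over `R`
    (∀ g : Fin (n + 1) → RationalMapDomain.CoordRing X,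
      g ∈ LinearMap.ker α.mulVecLin ↔
        ∀ i j, g i * Ideal.Quotient.mk (RationalMapDomain.vanishingIdeal X) (f j) =
          g j * Ideal.Quotient.mk (RationalMapDomain.vanishingIdeal X) (f i)) ∧
    -- the domain of definition, from any matrix `β` with `im β = ker α`
    (∀ (k : ℕ) (β : Matrix (Fin (n + 1)) (Fin k) (RationalMapDomain.CoordRing X)),
      LinearMap.range β.mulVecLin = LinearMap.ker α.mulVecLin →
        RationalMapDomain.IsDomainOfDefinition X f
          (X \ ⋂ l : Fin k, RationalMapDomain.zeroLocus
            ((Ideal.span (Set.range fun i => β i l)).comap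
              (Ideal.Quotient.mk (RationalMapDomain.vanishingIdeal X)) :
              Set (MvPolynomial (Fin (m + 1)) K)))) := by
  subst hX
  rw [RationalMapDomain.ker_eq_proportionalTuples
    (RationalMapDomain.le_vanishingIdeal_zeroLocus I)
    (RationalMapDomain.isPrime_vanishingIdeal hirr) hf0 hB hBhom hα]
  exact ⟨RationalMapDomain.isRepresentative_iff hirr hf hf0,
    RationalMapDomain.proportionalTuples_eq_span hirr hf hf0,
    fun g => RationalMapDomain.mem_proportionalTuples,
    fun k β hβ => RationalMapDomain.isDomainOfDefinition hirr hf hf0 hβ⟩
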